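/- For a finite simple graph $G$ with vertex set $V$, let $Z_G$ be the affine scheme over $\mathbb{Z}$ of nondegenerate symmetric matrices $M=(M_{ij})_{i,j\in V}$ such that $M_{ij}=0$ whenever there is an edge of $G$ joining $i$ and $j$; that is, $Z_G=\operatorname{Spec}\,(\mathbb{Z}[y_{ij} : i,j\in V]/J_G)_D$, where $J_G$ is the ideal generated by all $y_{ij}-y_{ji}$ and by the $y_{ij}$ with $\{i,j\}$ an edge of $G$, and $D=\det(y_{ij})$ is inverted. A scheme $X$ of finite type over $\mathbb{Z}$ is called polynomially countable, written $[X]\in\mathbb{Z}[q]$, if there is a polynomial $P\in\mathbb{Z}[q]$ such that $\#X(\mathbb{F}_q)=P(q)$ for every prime power $q$. Corollary. For every finite forest $F$ (a finite simple graph with no cycles), the scheme $Z_F$ is polynomially countable, i.e. $[Z_F]\in\mathbb{Z}[q]$. -/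

import Mathlib

open AlgebraicGeometry CategoryTheory

universe u

/-- The ideal of `ℤ[y_{ij}]` generated by the `y_{ij} - y_{ji}` and by the `y_{ij}` for which
`i` and `j` are joined by an edge of `G`. -/
noncomputable def zIdeal {V : Type u} (G : SimpleGraph V) : Ideal (MvPolynomial (V × V) ℤ) :=
  Ideal.span
    ({p | ∃ i j : V, p = MvPolynomial.X (i, j) - MvPolynomial.X (j, i)} ∪
      {p | ∃ i j : V, G.Adj i j ∧ p = MvPolynomial.X (i, j)})

/-- The determinant of the generic matrix `(y_{ij})`. -/
noncomputable def genericDet (V : Type u) [Fintype V] [DecidableEq V] :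
    MvPolynomial (V × V) ℤ :=
  Matrix.det (Matrix.of fun i j : V => MvPolynomial.X (i, j))

/-- The coordinate ring of `Z_G`: the quotient of `ℤ[y_{ij}]` by `zIdeal G`, localized at the
determinant. -/
abbrev ZRing {V : Type u} [Fintype V] [DecidableEq V] (G : SimpleGraph V) : Type u :=
  Localization.Away (Ideal.Quotient.mk (zIdeal G) (genericDet V))

/-- The scheme `Z_G` over `ℤ` of nondegenerate symmetric matrices `M`, indexed by the vertices
of `G`, with `M_{ij} = 0` whenever there is an edge from `i` to `j`. -/
noncomputable def ZScheme {V : Type u} [Fintype V] [DecidableEq V] (G : SimpleGraph V) :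
    Scheme.{u} :=
  Spec (CommRingCat.of (ZRing G))

/-- A scheme `X` is polynomially countable if there is one polynomial `P ∈ ℤ[q]` such that, for
every finite field `K`, the set `X(K)` is finite with `P(#K)` elements. (Morphisms of schemes are
automatically morphisms over `ℤ`.) -/
def PolynomiallyCountable (X : Scheme.{u}) : Prop :=
  ∃ P : Polynomial ℤ, ∀ (K : Type u) [Field K] [Finite K],
    Finite (Spec (CommRingCat.of K) ⟶ X) ∧
      (Nat.card (Spec (CommRingCat.of K) ⟶ X) : ℤ) = P.eval (Nat.card K : ℤ)

/-! Count the symmetric matrices with the prescribed zeros by rank, not only the invertible ones, by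
induction on the set S of allowed indices; matrices stay V × V, padded with zeros. In a forest some
v in S has at most one neighbour u in S. Deleting row and column v from M leaves A, and M is A
bordered by a vector b and a corner c. If b is outside the range of A, the rank rises by 2 for every
c; if b = Ax, it is unchanged for the single value c = xᵀAx and rises by 1 otherwise
(`sum_sum_rank_border`).

So only the number of admissible b in the range of A matters. Let r be the rank of A. The one
condition not automatic there is b_u = 0: it leaves q^r vectors if row u of A is zero (or there is
no u), and q^(r-1) otherwise. Matrices with zero row u are those supported on S \ {v, u}, so the
induction closes. Full rank picks out the points of Z_F. -/

/-- The symmetric matrices over `K` that vanish outside `S × S` and on the edges of `G`. -/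
def patternSet {V : Type u} (G : SimpleGraph V) (K : Type u) [Zero K] (S : Finset V) :
    Set (Matrix V V K) :=
  {M | M.IsSymm ∧ (∀ i j, i ∉ S → M i j = 0) ∧ ∀ i j, G.Adj i j → M i j = 0}

/-- The vectors that vanish outside `S` and at the neighbours of `v`. -/
def borderSet {V : Type u} (G : SimpleGraph V) (K : Type u) [Zero K] (S : Finset V) (v : V) :
    Set (V → K) :=
  {b | (∀ i, i ∉ S → b i = 0) ∧ ∀ i, G.Adj v i → b i = 0}

/-- The matrix obtained from `A` by adding the vector `b` to the row and the column of index `v`,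
and `c` to the diagonal entry of index `v`. -/
def border {V K : Type*} [DecidableEq V] [Semiring K] (A : Matrix V V K) (v : V) (b : V → K)
    (c : K) : Matrix V V K :=
  A + Matrix.vecMulVec b (Pi.single v 1) + Matrix.vecMulVec (Pi.single v 1) b +
    Matrix.vecMulVec (c • Pi.single v 1) (Pi.single v 1)

/-! ### Rank of a bordered symmetric matrix -/

section Rank

set_option linter.unusedSectionVars false

variable {V K : Type*} [Fintype V] [DecidableEq V] [Field K]

theorem border_mulVec (A : Matrix V V K) (v : V) (b : V → K) (c : K) (y : V → K) :
    (border A v b c).mulVec y =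
      A.mulVec y + y v • b + (b ⬝ᵥ y + c * y v) • Pi.single v 1 := by
  simp only [border, Matrix.add_mulVec, Matrix.vecMulVec_mulVec]
  ext i
  simp
  ring

theorem mulVec_apply_eq_zero_of_row {A : Matrix V V K} {v : V} (hr : ∀ j, A v j = 0) (y : V → K) :
    A.mulVec y v = 0 := by
  simp [Matrix.mulVec, dotProduct, hr]

theorem mulVec_single_of_col {A : Matrix V V K} {v : V} (hc : ∀ j, A j v = 0) :
    A.mulVec (Pi.single v 1) = 0 := by
  ext j
  simp [hc]

theorem dotProduct_mulVec_comm_of_isSymm {A : Matrix V V K} (hA : A.IsSymm) (x y : V → K) :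
    A.mulVec x ⬝ᵥ y = x ⬝ᵥ A.mulVec y := by
  rw [Matrix.dotProduct_mulVec, ← Matrix.mulVec_transpose, hA.eq]

/-- The range of a symmetric matrix is the orthogonal complement of its kernel. -/
theorem exists_mulVec_eq_zero_dotProduct_eq_one {A : Matrix V V K} (hA : A.IsSymm) {b : V → K}
    (hb : b ∉ LinearMap.range A.mulVecLin) : ∃ z, A.mulVec z = 0 ∧ b ⬝ᵥ z = 1 := by
  obtain ⟨f, hf, hf0⟩ := Submodule.exists_le_ker_of_notMem hb
  let z : V → K := fun i => f (Pi.single i 1)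
  have hz (y : V → K) : f y = z ⬝ᵥ y := by
    conv_lhs => rw [LinearMap.pi_apply_eq_sum_univ f y]
    refine Finset.sum_congr rfl fun i _ => ?_
    rw [smul_eq_mul, mul_comm]
    congr 2
    ext j
    simp [Pi.single_apply, eq_comm]
  have hfb : f b ≠ 0 := hf
  -- By symmetry Az · y = z · Ay = f(Ay), and f kills the range of A.
  have hAz : A.mulVec z = 0 := by
    apply dotProduct_eq_zero
    intro y
    rw [dotProduct_mulVec_comm_of_isSymm hA, ← hz]
    exact hf0 ⟨y, rfl⟩
  refine ⟨(f b)⁻¹ • z, by rw [Matrix.mulVec_smul, hAz, smul_zero], ?_⟩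
  rw [dotProduct_smul, dotProduct_comm, ← hz, smul_eq_mul, inv_mul_cancel₀ hfb]

theorem single_notMem_of_le {p : Submodule K (V → K)} {v : V} (hp : ∀ x ∈ p, x v = 0) :
    (Pi.single v 1 : V → K) ∉ p := fun h => by
  simpa using hp _ h

/-- A kernel vector of A not orthogonal to b puts e_v in the range of the border, hence also b; the
range is then range A ⊕ Kb ⊕ Ke_v. -/
theorem rank_border_of_notMem {A : Matrix V V K} (hA : A.IsSymm) {v : V} (hr : ∀ j, A v j = 0)
    {b : V → K} (hbv : b v = 0) (c : K) (hb : b ∉ LinearMap.range A.mulVecLin) :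
    (border A v b c).rank = A.rank + 2 := by
  obtain ⟨z, hz, hbz⟩ := exists_mulVec_eq_zero_dotProduct_eq_one hA hb
  have hcol : ∀ j, A j v = 0 := fun j => by rw [← hA.apply, hr]
  set e : V → K := Pi.single v 1
  have hAe : A.mulVec e = 0 := mulVec_single_of_col hcol
  have hbe : b ⬝ᵥ e = 0 := by simp [e, hbv]
  have hev : e v = 1 := by simp [e]
  have key : LinearMap.range (border A v b c).mulVecLin =
      (LinearMap.range A.mulVecLin ⊔ K ∙ b) ⊔ K ∙ e := by
    apply le_antisymm
    · rintro _ ⟨y, rfl⟩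
      rw [Matrix.mulVecLin_apply, border_mulVec]
      refine Submodule.add_mem_sup (Submodule.add_mem_sup ⟨y, rfl⟩ ?_) ?_ <;>
        exact Submodule.smul_mem _ _ (Submodule.mem_span_singleton_self _)
    · have he : e ∈ LinearMap.range (border A v b c).mulVecLin := by
        -- Removing the v-coordinate of z switches off the b and c terms; b · z = 1 is what remains.
        refine ⟨z - z v • e, ?_⟩
        rw [Matrix.mulVecLin_apply, border_mulVec, Matrix.mulVec_sub, Matrix.mulVec_smul, hAe, hz,
          dotProduct_sub, dotProduct_smul, hbe, hbz]
        simp [e]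
      have hbm : b ∈ LinearMap.range (border A v b c).mulVecLin := by
        have h : (border A v b c).mulVec e = b + c • e := by
          rw [border_mulVec, hAe, hbe, hev]
          simp [e]
        have : (border A v b c).mulVecLin e - c • e = b := by
          rw [Matrix.mulVecLin_apply, h, add_sub_cancel_right]
        have hmem := sub_mem (LinearMap.mem_range_self (border A v b c).mulVecLin e)
          (Submodule.smul_mem _ c he)
        rwa [this] at hmem
      refine sup_le (sup_le ?_ ?_) ?_
      · rintro _ ⟨y, rfl⟩
        have : A.mulVecLin y = (border A v b c).mulVecLin y - y v • b -
            (b ⬝ᵥ y + c * y v) • e := by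
          rw [Matrix.mulVecLin_apply, Matrix.mulVecLin_apply, border_mulVec]
          abel
        rw [this]
        exact sub_mem (sub_mem ⟨y, rfl⟩ (Submodule.smul_mem _ _ hbm)) (Submodule.smul_mem _ _ he)
      · rwa [Submodule.span_singleton_le_iff_mem]
      · rwa [Submodule.span_singleton_le_iff_mem]
  rw [Matrix.rank, key, Submodule.finrank_sup_span_singleton, Submodule.finrank_sup_span_singleton hb,
    Matrix.rank]
  apply single_notMem_of_le
  intro x hx
  obtain ⟨_, ⟨y, rfl⟩, w, hw, rfl⟩ := Submodule.mem_sup.1 hx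
  obtain ⟨t, rfl⟩ := Submodule.mem_span_singleton.1 hw
  simp [mulVec_apply_eq_zero_of_row hr, hbv]

/-- Completing the square: the scalar c - xᵀAx is the Schur complement of the corner. -/
theorem border_mulVec_mulVec {A : Matrix V V K} (hA : A.IsSymm) (v : V) (x : V → K) (c : K)
    (y : V → K) : (border A v (A.mulVec x) c).mulVec y =
      A.mulVec (y + y v • x) + (x ⬝ᵥ A.mulVec (y + y v • x)) • Pi.single v 1 +
        ((c - x ⬝ᵥ A.mulVec x) * y v) • Pi.single v 1 := by
  rw [border_mulVec, dotProduct_mulVec_comm_of_isSymm hA, Matrix.mulVec_add, Matrix.mulVec_smul,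
    dotProduct_add, dotProduct_smul, add_assoc (_ + _), ← add_smul]
  congr 2
  simp only [smul_eq_mul]
  ring

/-- With zero Schur complement the range is the graph of w ↦ x · w over the range of A. -/
theorem rank_border_mulVec_of_eq {A : Matrix V V K} (hA : A.IsSymm) {v : V}
    (hr : ∀ j, A v j = 0) (x : V → K) :
    (border A v (A.mulVec x) (x ⬝ᵥ A.mulVec x)).rank = A.rank := by
  have hcol : ∀ j, A j v = 0 := fun j => by rw [← hA.apply, hr]
  have hAe : A.mulVec (Pi.single v 1) = 0 := mulVec_single_of_col hcol
  let L : LinearMap.range A.mulVecLin →ₗ[K] (V → K) :=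
    (LinearMap.id + (Matrix.vecMulVec (Pi.single v 1) x).mulVecLin) ∘ₗ Submodule.subtype _
  have hL (y) : L y = y.1 + (x ⬝ᵥ y.1) • Pi.single v 1 := by
    simp [L, Matrix.vecMulVec_mulVec]
  have hinj : Function.Injective L := by
    rw [← LinearMap.ker_eq_bot, LinearMap.ker_eq_bot']
    rintro ⟨_, ⟨y, rfl⟩⟩ h
    rw [hL] at h
    have hv := congrFun h v
    simp only [Matrix.mulVecLin_apply, Pi.add_apply, mulVec_apply_eq_zero_of_row hr, zero_add,
      Pi.smul_apply, Pi.single_eq_same, smul_eq_mul, mul_one, Pi.zero_apply] at hv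
    simpa [hv] using h
  have key : LinearMap.range (border A v (A.mulVec x) (x ⬝ᵥ A.mulVec x)).mulVecLin =
      LinearMap.range L := by
    apply le_antisymm
    · rintro _ ⟨y, rfl⟩
      refine ⟨⟨A.mulVecLin (y + y v • x), LinearMap.mem_range_self _ _⟩, ?_⟩
      rw [hL, Matrix.mulVecLin_apply (border _ _ _ _), border_mulVec_mulVec hA]
      simp
    · rintro _ ⟨⟨_, ⟨y, rfl⟩⟩, rfl⟩
      refine ⟨y - y v • Pi.single v 1, ?_⟩
      rw [hL, Matrix.mulVecLin_apply, border_mulVec_mulVec hA]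
      simp [Matrix.mulVec_sub, Matrix.mulVec_smul, hAe]
  rw [Matrix.rank, key, LinearMap.finrank_range_of_inj hinj, Matrix.rank]

theorem rank_border_mulVec_of_ne {A : Matrix V V K} (hA : A.IsSymm) {v : V}
    (hr : ∀ j, A v j = 0) (x : V → K) {c : K} (hc : c ≠ x ⬝ᵥ A.mulVec x) :
    (border A v (A.mulVec x) c).rank = A.rank + 1 := by
  have hcol : ∀ j, A j v = 0 := fun j => by rw [← hA.apply, hr]
  have hAe : A.mulVec (Pi.single v 1) = 0 := mulVec_single_of_col hcol
  set e : V → K := Pi.single v 1 with hedef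
  have hev : e v = 1 := by simp [e]
  have key : LinearMap.range (border A v (A.mulVec x) c).mulVecLin =
      LinearMap.range A.mulVecLin ⊔ K ∙ e := by
    apply le_antisymm
    · rintro _ ⟨y, rfl⟩
      rw [Matrix.mulVecLin_apply, border_mulVec_mulVec hA, add_assoc, ← add_smul]
      exact Submodule.add_mem_sup ⟨_, rfl⟩
        (Submodule.smul_mem _ _ (Submodule.mem_span_singleton_self _))
    · have he : e ∈ LinearMap.range (border A v (A.mulVec x) c).mulVecLin := by
        -- The vector y = (1 + x_v)e - x has y_v = 1, and y + y_v x is a multiple of e, which A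
        -- kills; only the Schur complement term survives.
        refine ⟨(c - x ⬝ᵥ A.mulVec x)⁻¹ • ((1 + x v) • e - x), ?_⟩
        rw [map_smul, Matrix.mulVecLin_apply, border_mulVec_mulVec hA]
        have : A.mulVec ((1 + x v) • e - x + ((1 + x v) • e - x) v • x) = 0 := by
          simp [Matrix.mulVec_smul, hAe, hev]
        rw [this]
        simp [hev, smul_smul, sub_ne_zero.2 hc, ← hedef]
      refine sup_le ?_ (by rwa [Submodule.span_singleton_le_iff_mem])
      rintro _ ⟨y, rfl⟩
      have : A.mulVecLin y = (border A v (A.mulVec x) c).mulVecLin (y - y v • e) -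
          (x ⬝ᵥ A.mulVec y) • e := by
        rw [Matrix.mulVecLin_apply, Matrix.mulVecLin_apply, border_mulVec_mulVec hA]
        simp [Matrix.mulVec_sub, Matrix.mulVec_smul, hAe, hev, ← hedef]
      rw [this]
      exact sub_mem ⟨_, rfl⟩ (Submodule.smul_mem _ _ he)
  rw [Matrix.rank, key, Submodule.finrank_sup_span_singleton, Matrix.rank]
  apply single_notMem_of_le
  rintro _ ⟨y, rfl⟩
  exact mulVec_apply_eq_zero_of_row hr y

end Rank

/-! ### Counting borders over a finite field -/

section Counting

set_option linter.unusedSectionVars false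

variable {V K : Type u} [Fintype V] [DecidableEq V] [Field K]

theorem border_apply_of_ne (A : Matrix V V K) {v : V} (b : V → K) (c : K) {i j : V} (hi : i ≠ v)
    (hj : j ≠ v) : border A v b c i j = A i j := by
  simp [border, Matrix.vecMulVec_apply, hi, hj]

theorem border_apply_same_right (A : Matrix V V K) {v : V} (b : V → K) (c : K) {i : V}
    (hi : i ≠ v) : border A v b c i v = A i v + b i := by
  simp [border, Matrix.vecMulVec_apply, hi]

theorem border_apply_same_left (A : Matrix V V K) {v : V} (b : V → K) (c : K) {j : V}
    (hj : j ≠ v) : border A v b c v j = A v j + b j := by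
  simp [border, Matrix.vecMulVec_apply, hj]

theorem border_apply_same (A : Matrix V V K) {v : V} {b : V → K} (hb : b v = 0) (c : K) :
    border A v b c v v = A v v + c := by
  simp [border, Matrix.vecMulVec_apply, hb]

theorem border_mem_patternSet {G : SimpleGraph V} {S : Finset V} {v : V} (hv : v ∈ S)
    {A : Matrix V V K} (hA : A ∈ patternSet G K (S.erase v)) {b : V → K}
    (hb : b ∈ borderSet G K (S.erase v) v) (c : K) : border A v b c ∈ patternSet G K S := by
  obtain ⟨hs, h0, hG⟩ := hA
  obtain ⟨hb0, hbG⟩ := hb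
  have hbv : b v = 0 := hb0 v (by simp)
  refine ⟨?_, fun i j hi => ?_, fun i j hij => ?_⟩
  · have : A.transpose = A := hs
    simp only [border, Matrix.IsSymm, Matrix.transpose_add, Matrix.transpose_vecMulVec, this]
    rw [add_right_comm A]
    congr 1
    ext i j
    simp [Matrix.vecMulVec_apply, mul_left_comm, mul_assoc]
  · have hiv : i ≠ v := fun h => hi (h ▸ hv)
    have hi' : i ∉ S.erase v := fun h => hi (Finset.mem_of_mem_erase h)
    simp [border, Matrix.vecMulVec_apply, hiv, h0 i j hi', hb0 i hi']
  · rcases eq_or_ne i v with rfl | hi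
    · rw [border_apply_same_left A b c hij.ne', hG _ _ hij, hbG _ hij, add_zero]
    · rcases eq_or_ne j v with rfl | hj
      · rw [border_apply_same_right A b c hij.ne, hG _ _ hij, hbG _ hij.symm, add_zero]
      · rw [border_apply_of_ne A b c hi hj, hG _ _ hij]

open Classical in
/-- Summation over bordered matrices. -/
theorem sum_patternSet_eq_sum_border [Fintype K] (G : SimpleGraph V) {S : Finset V} {v : V}
    (hv : v ∈ S) (f : Matrix V V K → ℤ) :
    ∑ M with M ∈ patternSet G K S, f M =
      ∑ A with A ∈ patternSet G K (S.erase v),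
        ∑ b with b ∈ borderSet G K (S.erase v) v, ∑ c, f (border A v b c) := by
  simp_rw [← Finset.sum_product']
  symm
  refine Finset.sum_nbij' (fun p => border p.1 v p.2.1 p.2.2)
    (fun M => (Matrix.of fun i j => if i = v ∨ j = v then 0 else M i j,
      fun i => if i = v then 0 else M i v, M v v)) ?_ ?_ ?_ ?_ ?_
  · rintro ⟨A, b, c⟩ h
    simp only [Finset.mem_product, Finset.mem_filter, Finset.mem_univ, true_and, and_true] at h ⊢
    exact border_mem_patternSet hv h.1 h.2 c
  · intro M h
    simp only [Finset.mem_product, Finset.mem_filter, Finset.mem_univ, true_and, and_true] at h ⊢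
    obtain ⟨hs, h0, hG⟩ := h
    refine ⟨⟨?_, fun i j hi => ?_, fun i j hij => ?_⟩, fun i hi => ?_, fun i hi => ?_⟩
    · ext i j
      simp [Matrix.transpose_apply, or_comm, hs.apply]
    · rw [Matrix.of_apply]
      split_ifs with h
      · rfl
      · exact h0 _ _ fun hiS => hi (Finset.mem_erase.2 ⟨fun e => h (.inl e), hiS⟩)
    · rw [Matrix.of_apply]
      split_ifs
      · rfl
      · exact hG _ _ hij
    · dsimp only
      split_ifs with h
      · rfl
      · exact h0 _ _ fun hiS => hi (Finset.mem_erase.2 ⟨h, hiS⟩)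
    · dsimp only
      split_ifs
      · rfl
      · exact hG _ _ hi.symm
  · rintro ⟨A, b, c⟩ h
    simp only [Finset.mem_product, Finset.mem_filter, Finset.mem_univ, true_and, and_true] at h
    obtain ⟨⟨hs, h0, hG⟩, hb0, hbG⟩ := h
    have hrow (j) : A v j = 0 := h0 v j (by simp)
    have hcol (j) : A j v = 0 := by rw [← hs.apply, hrow]
    have hbv : b v = 0 := hb0 v (by simp)
    refine Prod.ext ?_ (Prod.ext ?_ ?_)
    · ext i j
      dsimp only [Matrix.of_apply]
      split_ifs with h
      · rcases h with rfl | rfl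
        · rw [hrow]
        · rw [hcol]
      · rw [not_or] at h
        rw [border_apply_of_ne A b c h.1 h.2]
    · ext i
      dsimp only
      split_ifs with h
      · rw [h, hbv]
      · rw [border_apply_same_right A b c h, hcol, zero_add]
    · dsimp only
      rw [border_apply_same A hbv, hrow, zero_add]
  · intro M h
    simp only [Finset.mem_filter, Finset.mem_univ, true_and] at h
    ext i j
    rcases eq_or_ne i v with rfl | hi
    · rcases eq_or_ne j i with rfl | hj
      · rw [border_apply_same _ (by simp)]
        simp
      · rw [border_apply_same_left _ _ _ hj]
        simp [hj, h.1.apply]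
    · rcases eq_or_ne j v with rfl | hj
      · rw [border_apply_same_right _ _ _ hi]
        simp [hi]
      · rw [border_apply_of_ne _ _ _ hi hj]
        simp [hi, hj]
  · intros
    rfl

open Classical in
theorem sum_rank_border_of_mem [Fintype K] {A : Matrix V V K} (hA : A.IsSymm) {v : V}
    (hr : ∀ j, A v j = 0) {b : V → K} (hb : b ∈ LinearMap.range A.mulVecLin) (g : ℕ → ℤ) :
    ∑ c, g (border A v b c).rank = g A.rank + (Nat.card K - 1) * g (A.rank + 1) := by
  obtain ⟨x, rfl⟩ := hb
  rw [Matrix.mulVecLin_apply, ← Finset.add_sum_erase _ _ (Finset.mem_univ (x ⬝ᵥ A.mulVec x)),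
    rank_border_mulVec_of_eq hA hr, Finset.sum_congr rfl fun c hc => by
      rw [rank_border_mulVec_of_ne hA hr x (Finset.ne_of_mem_erase hc)],
    Finset.sum_const, Finset.card_erase_of_mem (Finset.mem_univ _), Finset.card_univ, nsmul_eq_mul,
    Nat.cast_sub Fintype.card_pos, Nat.card_eq_fintype_card, Nat.cast_one]

theorem sum_rank_border_of_notMem [Fintype K] {A : Matrix V V K} (hA : A.IsSymm) {v : V}
    (hr : ∀ j, A v j = 0) {b : V → K} (hbv : b v = 0) (hb : b ∉ LinearMap.range A.mulVecLin)
    (g : ℕ → ℤ) :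
    ∑ c, g (border A v b c).rank = Nat.card K * g (A.rank + 2) := by
  simp [rank_border_of_notMem hA hr hbv _ hb]

open Classical in
theorem sum_sum_rank_border [Fintype K] {A : Matrix V V K} (hA : A.IsSymm) {v : V}
    (hr : ∀ j, A v j = 0) (B : Finset (V → K)) (hB : ∀ b ∈ B, b v = 0) (g : ℕ → ℤ) :
    ∑ b ∈ B, ∑ c, g (border A v b c).rank =
      (B.filter (· ∈ LinearMap.range A.mulVecLin)).card *
        (g A.rank + (Nat.card K - 1) * g (A.rank + 1)) +
      (B.card - (B.filter (· ∈ LinearMap.range A.mulVecLin)).card) *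
        (Nat.card K * g (A.rank + 2)) := by
  rw [← Finset.sum_filter_add_sum_filter_not B (· ∈ LinearMap.range A.mulVecLin)]
  have hcard := Finset.card_filter_add_card_filter_not (s := B)
    (fun b => b ∈ LinearMap.range A.mulVecLin)
  rw [Finset.sum_congr rfl fun b hb => sum_rank_border_of_mem hA hr (Finset.mem_filter.1 hb).2 g,
    Finset.sum_congr (s₁ := B.filter fun b => b ∉ LinearMap.range A.mulVecLin) rfl fun b hb =>
      sum_rank_border_of_notMem hA hr (hB b (Finset.mem_filter.1 hb).1) (Finset.mem_filter.1 hb).2 g,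
    Finset.sum_const, Finset.sum_const, nsmul_eq_mul, nsmul_eq_mul, ← hcard]
  push_cast
  ring

open Classical in
theorem card_borderSet [Fintype K] (G : SimpleGraph V) (S : Finset V) (v : V) :
    (Finset.univ.filter (· ∈ borderSet G K S v)).card =
      Nat.card K ^ (S.filter fun i => ¬ G.Adj v i).card := by
  have h : (Finset.univ.filter (· ∈ borderSet G K S v)) =
      Fintype.piFinset fun i => if i ∈ S ∧ ¬ G.Adj v i then Finset.univ else {(0 : K)} := by
    ext b
    rw [Finset.mem_filter_univ, Fintype.mem_piFinset]
    constructor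
    · rintro ⟨h1, h2⟩ i
      split_ifs with h
      · simp
      · rw [Finset.mem_singleton]
        by_cases hi : i ∈ S
        · exact h2 i (by tauto)
        · exact h1 i hi
    · intro h
      refine ⟨fun i hi => ?_, fun i hi => ?_⟩ <;>
      · have := h i
        rwa [if_neg (by tauto), Finset.mem_singleton] at this
  rw [h, Fintype.card_piFinset, Finset.prod_congr rfl fun i _ => apply_ite Finset.card _ _ _,
    Finset.prod_ite]
  simp [Finset.card_univ, ← Finset.filter_filter]

open Classical in
theorem card_filter_range [Fintype K] (A : Matrix V V K) :
    (Finset.univ.filter (· ∈ LinearMap.range A.mulVecLin)).card = Nat.card K ^ A.rank := by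
  rw [← Fintype.card_subtype, ← Nat.card_eq_fintype_card, Matrix.rank,
    ← Module.natCard_eq_pow_finrank]

-- The coordinate u is a nonzero functional on the range of A, so its kernel there has codimension
-- one.
open Classical in
theorem card_filter_range_of_row_ne_zero [Fintype K] (A : Matrix V V K) {u j : V}
    (huj : A u j ≠ 0) :
    (Finset.univ.filter fun b => b ∈ LinearMap.range A.mulVecLin ∧ b u = 0).card =
      Nat.card K ^ (A.rank - 1) := by
  let f : LinearMap.range A.mulVecLin →ₗ[K] K := LinearMap.proj u ∘ₗ Submodule.subtype _
  have hf : LinearMap.range f = ⊤ := by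
    rw [LinearMap.range_eq_top]
    refine LinearMap.surjective_of_ne_zero fun h => huj ?_
    have := LinearMap.congr_fun h ⟨A.mulVecLin (Pi.single j 1), LinearMap.mem_range_self _ _⟩
    simpa [f] using this
  have hker : Module.finrank K (LinearMap.ker f) = A.rank - 1 := by
    have := LinearMap.finrank_range_add_finrank_ker f
    rw [hf, finrank_top, Module.finrank_self] at this
    rw [Matrix.rank, ← this, Nat.add_sub_cancel_left]
  rw [← hker, ← Module.natCard_eq_pow_finrank (V := LinearMap.ker f), ← Fintype.card_subtype, ← Nat.card_eq_fintype_card]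
  exact Nat.card_congr
    { toFun := fun b => ⟨⟨b.1, b.2.1⟩, b.2.2⟩
      invFun := fun b => ⟨b.1.1, b.1.2, b.2⟩
      left_inv := fun _ => rfl
      right_inv := fun _ => rfl }

end Counting

/-! ### Leaves of forests -/

/-- Every nonempty finite set of vertices of a forest contains a vertex with at most one neighbour
in that set. -/
theorem SimpleGraph.IsAcyclic.exists_mem_forall_adj_eq {V : Type*} {G : SimpleGraph V}
    (hG : G.IsAcyclic) {S : Finset V} (hS : S.Nonempty) :
    ∃ v ∈ S, ∃ u, ∀ w ∈ S, G.Adj v w → w = u := by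
  classical
  let H := G.induce (S : Set V)
  have hH : H.IsAcyclic := hG.induce _
  obtain ⟨x, hx⟩ := hS
  -- The start of a longest path works: a neighbour off the path would extend it, and one on the
  -- path must be its second vertex by acyclicity.
  let P : ℕ → Prop := fun n => ∃ (a b : (S : Set V)) (p : H.Walk a b), p.IsPath ∧ p.length = n
  have hP0 : P 0 := ⟨⟨x, hx⟩, ⟨x, hx⟩, .nil, by simp, rfl⟩
  obtain ⟨a, b, p, hp, hlen⟩ := Nat.findGreatest_spec (P := P) (Nat.zero_le (Fintype.card (S : Set V))) hP0
  refine ⟨a.1, a.2, p.snd.1, fun w hw haw => ?_⟩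
  have hadj : H.Adj a ⟨w, hw⟩ := haw
  by_cases hsupp : (⟨w, hw⟩ : (S : Set V)) ∈ p.support
  · exact congrArg Subtype.val (hH.eq_snd_of_adj_start hp hadj hsupp)
  · have hq : (p.cons hadj.symm).IsPath := (SimpleGraph.Walk.cons_isPath_iff _ _).2 ⟨hp, hsupp⟩
    have := Nat.le_findGreatest (P := P) hq.length_lt.le ⟨_, _, _, hq, rfl⟩
    rw [SimpleGraph.Walk.length_cons, hlen] at this
    omega

/-! ### Points of Z_G as matrices -/

section Points

variable {V : Type u} [Fintype V] [DecidableEq V] (G : SimpleGraph V) (K : Type u) [Field K]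

/-- Evaluation of polynomials in the matrix entries at a matrix in `patternSet`. -/
noncomputable def evalQuotient (M : Matrix V V K) (hM : M ∈ patternSet G K Finset.univ) :
    MvPolynomial (V × V) ℤ ⧸ zIdeal G →+* K :=
  Ideal.Quotient.lift (zIdeal G)
    (MvPolynomial.eval₂Hom (Int.castRingHom K) fun p : V × V => M p.1 p.2) (by
      intro a ha
      rw [← RingHom.mem_ker]
      refine (Ideal.span_le.2 ?_ : zIdeal G ≤ _) ha
      rintro _ (⟨i, j, rfl⟩ | ⟨i, j, hij, rfl⟩)
      · simp [RingHom.mem_ker, hM.1.apply]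
      · simp [RingHom.mem_ker, hM.2.2 i j hij])

theorem map_genericDet {R : Type*} [CommRing R] (f : MvPolynomial (V × V) ℤ →+* R) :
    f (genericDet V) = (Matrix.of fun i j => f (MvPolynomial.X (i, j))).det := by
  rw [genericDet, RingHom.map_det]
  rfl

theorem evalQuotient_genericDet (M : Matrix V V K) (hM : M ∈ patternSet G K Finset.univ) :
    evalQuotient G K M hM (Ideal.Quotient.mk (zIdeal G) (genericDet V)) = M.det := by
  rw [evalQuotient, Ideal.Quotient.lift_mk, map_genericDet]
  simp
  rfl

/-- The homomorphisms from the coordinate ring of `Z_G` to `K` are the nondegenerate matrices. -/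
noncomputable def zRingHomEquiv :
    (ZRing G →+* K) ≃ {M : Matrix V V K // M ∈ patternSet G K Finset.univ ∧ M.det ≠ 0} where
  toFun φ := ⟨Matrix.of fun i j => φ (algebraMap _ _ (Ideal.Quotient.mk (zIdeal G) (MvPolynomial.X (i, j)))),
    ⟨by
      ext i j
      simp only [Matrix.transpose_apply, Matrix.of_apply]
      congr 2
      exact Ideal.Quotient.eq.2 (Ideal.subset_span (.inl ⟨j, i, rfl⟩)), by simp, fun i j hij => by
      have : Ideal.Quotient.mk (zIdeal G) (MvPolynomial.X (i, j)) = 0 :=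
        Ideal.Quotient.eq_zero_iff_mem.2 (Ideal.subset_span (.inr ⟨i, j, hij, rfl⟩))
      simp [this]⟩, by
      have h := ((IsLocalization.Away.algebraMap_isUnit (S := ZRing G)
        (Ideal.Quotient.mk (zIdeal G) (genericDet V))).map φ).ne_zero
      have h2 := map_genericDet ((φ.comp (algebraMap _ (ZRing G))).comp
        (Ideal.Quotient.mk (zIdeal G)))
      exact fun h0 => h (h2.trans h0)⟩
  invFun M := IsLocalization.Away.lift (Ideal.Quotient.mk (zIdeal G) (genericDet V))
    (g := evalQuotient G K M.1 M.2.1) (by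
      rw [evalQuotient_genericDet]
      exact isUnit_iff_ne_zero.2 M.2.2)
  left_inv φ := by
    refine IsLocalization.ringHom_ext
      (Submonoid.powers (Ideal.Quotient.mk (zIdeal G) (genericDet V))) ?_
    rw [IsLocalization.Away.lift_comp]
    refine Ideal.Quotient.ringHom_ext (MvPolynomial.ringHom_ext' (RingHom.ext_int _ _) fun p => ?_)
    simp [evalQuotient]
  right_inv M := by
    ext i j
    simp only [Matrix.of_apply, IsLocalization.Away.lift_eq]
    simp [evalQuotient]

/-- The `K`-points of `Z_G` are the nondegenerate matrices over `K`. -/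
noncomputable def zSchemePointsEquiv :
    (Spec (CommRingCat.of K) ⟶ ZScheme G) ≃
      {M : Matrix V V K // M ∈ patternSet G K Finset.univ ∧ M.det ≠ 0} :=
  (Spec.homEquiv.trans ⟨CommRingCat.Hom.hom, CommRingCat.ofHom, fun _ => rfl, fun _ => rfl⟩).trans
    (zRingHomEquiv G K)

end Points

theorem rank_eq_card_iff_det_ne_zero {V K : Type*} [Fintype V] [DecidableEq V] [Field K]
    (M : Matrix V V K) : M.rank = Fintype.card V ↔ M.det ≠ 0 := by
  refine ⟨fun h hdet => ?_, Matrix.rank_of_det_ne_zero⟩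
  obtain ⟨x, hx0, hx⟩ := Matrix.exists_mulVec_eq_zero_iff.2 hdet
  have := LinearMap.finrank_range_add_finrank_ker M.mulVecLin
  rw [← Matrix.rank, h, Module.finrank_fintype_fun_eq_card, Nat.add_eq_left,
    Submodule.finrank_eq_zero] at this
  exact hx0 ((Submodule.eq_bot_iff _).1 this x (by simpa using hx))

/-! ### Admissible borders in the range, and the induction -/

section Recursion

set_option linter.unusedSectionVars false

variable {V K : Type u} [Fintype V] [DecidableEq V] [Field K]

theorem apply_eq_zero_of_mem_range {G : SimpleGraph V} {S : Finset V} {A : Matrix V V K}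
    (hA : A ∈ patternSet G K S) {b : V → K} (hb : b ∈ LinearMap.range A.mulVecLin) {i : V}
    (hi : i ∉ S) : b i = 0 := by
  obtain ⟨y, rfl⟩ := hb
  exact mulVec_apply_eq_zero_of_row (fun j => hA.2.1 i j hi) y

theorem mem_patternSet_erase_iff {G : SimpleGraph V} {S : Finset V} {u : V} {A : Matrix V V K} :
    A ∈ patternSet G K (S.erase u) ↔ A ∈ patternSet G K S ∧ ∀ j, A u j = 0 := by
  refine ⟨fun ⟨h, h0, hG⟩ => ⟨⟨h, fun i j hi => h0 i j fun hi' => hi (Finset.mem_of_mem_erase hi'),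
    hG⟩, fun j => h0 u j (by simp)⟩, fun ⟨⟨h, h0, hG⟩, hu⟩ => ⟨h, fun i j hi => ?_, hG⟩⟩
  rcases eq_or_ne i u with rfl | hiu
  · exact hu j
  · exact h0 i j fun hiS => hi (Finset.mem_erase.2 ⟨hiu, hiS⟩)

open Classical in
theorem card_borderSet_inter_range_of_forall [Fintype K] {G : SimpleGraph V} {S : Finset V} {v : V}
    {A : Matrix V V K} (hA : A ∈ patternSet G K S) (h : ∀ w ∈ S, G.Adj v w → ∀ j, A w j = 0) :
    (Finset.filter (· ∈ LinearMap.range A.mulVecLin)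
      (Finset.univ.filter (· ∈ borderSet G K S v))).card = Nat.card K ^ A.rank := by
  rw [← card_filter_range, Finset.filter_filter]
  congr 1
  ext b
  simp only [Finset.mem_filter, Finset.mem_univ, true_and, and_iff_right_iff_imp]
  refine fun hb => ⟨fun i hi => apply_eq_zero_of_mem_range hA hb hi, fun i hi => ?_⟩
  by_cases hiS : i ∈ S
  · obtain ⟨y, rfl⟩ := hb
    exact mulVec_apply_eq_zero_of_row (h i hiS hi) y
  · exact apply_eq_zero_of_mem_range hA hb hiS

open Classical in
theorem card_borderSet_inter_range_of_row_ne_zero [Fintype K] {G : SimpleGraph V} {S : Finset V}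
    {u v j : V} {A : Matrix V V K} (hA : A ∈ patternSet G K S) (huv : G.Adj v u)
    (hu : ∀ w ∈ S, G.Adj v w → w = u) (huj : A u j ≠ 0) :
    (Finset.filter (· ∈ LinearMap.range A.mulVecLin)
      (Finset.univ.filter (· ∈ borderSet G K S v))).card = Nat.card K ^ (A.rank - 1) := by
  rw [← card_filter_range_of_row_ne_zero A huj, Finset.filter_filter]
  congr 1
  ext b
  simp only [Finset.mem_filter, Finset.mem_univ, true_and]
  refine ⟨fun h => ⟨h.2, h.1.2 u huv⟩, fun ⟨hb, hbu⟩ =>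
    ⟨⟨fun i hi => apply_eq_zero_of_mem_range hA hb hi, fun i hi => ?_⟩, hb⟩⟩
  by_cases hiS : i ∈ S
  · rw [hu i hiS hi, hbu]
  · exact apply_eq_zero_of_mem_range hA hb hiS

end Recursion

open Polynomial Classical in
/-- For a forest, every sum over the matrices in `patternSet` of a weight that depends polynomially
on `q` and otherwise only on the rank is itself polynomial in `q`. -/
theorem exists_polynomial_sum_rank {V : Type u} [Fintype V] [DecidableEq V] {G : SimpleGraph V}
    (hG : G.IsAcyclic) (S : Finset V) (g : ℕ → ℤ[X]) :
    ∃ P : ℤ[X], ∀ (K : Type u) [Field K] [Fintype K],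
      ∑ M : Matrix V V K with M ∈ patternSet G K S, (g M.rank).eval (Nat.card K : ℤ) =
        P.eval (Nat.card K : ℤ) := by
  induction S using Finset.strongInduction generalizing g with
  | H S ih =>
  rcases S.eq_empty_or_nonempty with rfl | hS
  · refine ⟨g 0, fun K _ _ => ?_⟩
    have : (Finset.univ.filter fun M : Matrix V V K => M ∈ patternSet G K ∅) = {0} := by
      ext M
      simp only [Finset.mem_filter, Finset.mem_univ, true_and, Finset.mem_singleton]
      refine ⟨fun h => ?_, ?_⟩
      · ext i j
        exact h.2.1 i j (by simp)
      · rintro rfl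
        exact ⟨Matrix.isSymm_zero, fun _ _ _ => rfl, fun _ _ _ => rfl⟩
    rw [this, Finset.sum_singleton, Matrix.rank_zero]
  obtain ⟨v, hv, u, hu⟩ := hG.exists_mem_forall_adj_eq hS
  set T := S.erase v with hT
  have huT : ∀ w ∈ T, G.Adj v w → w = u := fun w hw => hu w (Finset.mem_of_mem_erase hw)
  let m := (T.filter fun i => ¬ G.Adj v i).card
  -- the inner sum over the borders of `A`, if `q ^ k` borders lie in the range of `A`
  let W : ℕ → ℕ → ℤ[X] := fun k r =>
    X ^ k * (g r + (X - 1) * g (r + 1)) + (X ^ m - X ^ k) * (X * g (r + 2))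
  have hW (K : Type u) [Field K] [Fintype K] (A : Matrix V V K) (hA : A ∈ patternSet G K T) (k : ℕ)
      (hk : (Finset.filter (· ∈ LinearMap.range A.mulVecLin)
        (Finset.univ.filter (· ∈ borderSet G K T v))).card = Nat.card K ^ k) :
      ∑ b with b ∈ borderSet G K T v, ∑ c, (g (border A v b c).rank).eval (Nat.card K : ℤ) =
        (W k A.rank).eval (Nat.card K : ℤ) := by
    rw [sum_sum_rank_border hA.1 (fun j => hA.2.1 v j (by simp [hT])) _
      (fun b hb => (Finset.mem_filter.1 hb).2.1 v (by simp [hT]))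
      (fun r => (g r).eval (Nat.card K : ℤ)), hk, card_borderSet]
    simp [W, m]
  -- P treats every A as if its row u were nonzero; Q corrects the A whose row u vanishes. The
  -- truncated r - 1 at r = 0 is harmless, since then row u is zero and the correction replaces that
  -- term.
  by_cases huv : u ∈ T ∧ G.Adj v u
  · obtain ⟨P, hP⟩ := ih T (Finset.erase_ssubset hv) fun r => W (r - 1) r
    obtain ⟨Q, hQ⟩ := ih (T.erase u)
      ((Finset.erase_subset _ _).trans_ssubset (Finset.erase_ssubset hv))
      fun r => W r r - W (r - 1) r
    refine ⟨P + Q, fun K _ _ => ?_⟩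
    rw [eval_add, ← hP, ← hQ, sum_patternSet_eq_sum_border G hv]
    have hfilter : (Finset.univ.filter fun A : Matrix V V K => A ∈ patternSet G K (T.erase u)) =
        (Finset.univ.filter fun A : Matrix V V K => A ∈ patternSet G K T).filter
          fun A => ∀ j, A u j = 0 := by
      ext A
      simp [mem_patternSet_erase_iff]
    rw [hfilter, Finset.sum_filter fun A : Matrix V V K => ∀ j, A u j = 0, ← Finset.sum_add_distrib]
    refine Finset.sum_congr rfl fun A hA => ?_
    replace hA := (Finset.mem_filter.1 hA).2
    split_ifs with hrow
    · rw [hW K A hA A.rank (card_borderSet_inter_range_of_forall hA fun w hw hvw =>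
        huT w hw hvw ▸ hrow), eval_sub]
      ring
    · obtain ⟨j, hj⟩ := not_forall.1 hrow
      rw [hW K A hA _ (card_borderSet_inter_range_of_row_ne_zero hA huv.2 huT hj), add_zero]
  · obtain ⟨P, hP⟩ := ih T (Finset.erase_ssubset hv) fun r => W r r
    refine ⟨P, fun K _ _ => ?_⟩
    rw [← hP, sum_patternSet_eq_sum_border G hv]
    refine Finset.sum_congr rfl fun A hA => ?_
    replace hA := (Finset.mem_filter.1 hA).2
    refine hW K A hA _ (card_borderSet_inter_range_of_forall hA fun w hw hvw => ?_)
    obtain rfl := huT w hw hvw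
    exact absurd ⟨hw, hvw⟩ huv

theorem mainTheorem8 {V : Type u} [Fintype V] [DecidableEq V] (F : SimpleGraph V)
    (hF : F.IsAcyclic) : PolynomiallyCountable (ZScheme F) := by
  classical
  -- The weight is the indicator of full rank, that is, of nonzero determinant.
  obtain ⟨P, hP⟩ := exists_polynomial_sum_rank hF Finset.univ
    fun r => if r = Fintype.card V then 1 else 0
  refine ⟨P, fun K _ _ => ?_⟩
  have := Fintype.ofFinite K
  refine ⟨Finite.of_equiv _ (zSchemePointsEquiv F K).symm, ?_⟩
  rw [← hP, Nat.card_congr (zSchemePointsEquiv F K), Nat.card_eq_fintype_card,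
    Fintype.card_subtype, ← Finset.filter_filter, Finset.card_filter]
  push_cast
  refine Finset.sum_congr rfl fun M _ => ?_
  simp only [← rank_eq_card_iff_det_ne_zero]
  split_ifs <;> simp
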